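/- Let $E$ be a Riesz space (real vector lattice, not necessarily Archimedean) with a strong unit $1_E$, i.e. for every $f\in E$ there is $n\in\mathbb N$ with $|f|\le n\,1_E$. Let $F$ be an Archimedean Riesz space and let $A:E\times E\to F$ be a bilinear map which is positive ($A(f,g)\ge 0$ for $f,g\ge 0$) and orthosymmetric ($f\wedge g=0$ implies $A(f,g)=0$). Let $\bar E$ be an f-algebra with multiplicative unit $1$, that is, a Riesz space with an associative bilinear multiplication such that $ab\ge0$ for $a,b\ge0$ and such that $a\wedge b=0$, $c\ge 0$ imply $(ca)\wedge b=(ac)\wedge b=0$. Suppose that $E$ is dense in $\bar E$ in the following sense: there is given a Riesz morphism (linear lattice homomorphism) $\iota:E\to\bar E$ with $\iota(1_E)=1$ which preserves the norm $\|a\|=\inf\{q\ge 0: |a|\le q1\}$ and for which, for every $x\in\bar E$ and $\varepsilon>0$, there is $f\in E$ with $|x-\iota(f)|\le\varepsilon 1$. (For instance, $E$ may be a uniformly dense Riesz subspace of $\bar E$ with $1_E=1$, and $\iota$ the inclusion.) Let $j:F\to F'$ be the uniform completion of $F$: $F'$ is an Archimedean (relatively) uniformly complete Riesz space, $j$ is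 an injective Riesz morphism, and no proper Riesz subspace of $F'$ containing $j(F)$ is uniformly complete. Here a Riesz space is uniformly complete if every sequence $(x_n)$ in it that is $u$-uniformly Cauchy for some $u\ge0$ in it (for all $\varepsilon>0$, $|x_m-x_n|\le\varepsilon u$ for all large $m,n$) converges $u$-uniformly to some element $l$ of it (for all $\varepsilon>0$, $|x_n-l|\le\varepsilon u$ for all large $n$). Then there is exactly one orthosymmetric positive bilinear map $A':\bar E\times\bar E\to F'$ that extends $A$, in the sense that $A'(\iota(f),\iota(g))=j(A(f,g))$ for all $f,g\in E$; moreover $$ j(A(f,g)) = A'\bigl(1,\iota(f)\,\iota(g)\bigr)\qquad\text{for all } f,g\in E. $$ -/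

import Mathlib

/-- A Riesz space (real vector lattice): a real vector space with a lattice order that is
translation invariant and invariant under multiplication by nonnegative scalars. -/
class IsRieszSpace (E : Type*) [AddCommGroup E] [Lattice E] [Module ℝ E] : Prop
    extends IsOrderedAddMonoid E, IsOrderedModule ℝ E

/-- A (unital, associative, not necessarily commutative) f-algebra: a Riesz space that is an
algebra with `0 ≤ a * b` for `0 ≤ a, b`, in which multiplication by positive elements,
from either side, preserves disjointness. -/
class IsFAlgebra (B : Type*) [Ring B] [Lattice B] [Algebra ℝ B] : Prop
    extends IsRieszSpace B, IsOrderedRing B where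
  mul_left_inf_eq_zero : ∀ a b c : B, a ⊓ b = 0 → 0 ≤ c → (c * a) ⊓ b = 0
  mul_right_inf_eq_zero : ∀ a b c : B, a ⊓ b = 0 → 0 ≤ c → (a * c) ⊓ b = 0

namespace Riesz

/-- A (strong) unit of a Riesz space. -/
def IsStrongUnit {E : Type*} [AddCommGroup E] [Lattice E] (e : E) : Prop :=
  ∀ f : E, ∃ n : ℕ, |f| ≤ n • e

/-- The Archimedean property of Riesz spaces (Mathlib's `Archimedean` is a different notion
for orders that are not linear). -/
def IsArchimedean (F : Type*) [AddCommGroup F] [Lattice F] : Prop :=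
  ∀ x y : F, (∀ n : ℕ, n • |x| ≤ y) → x = 0

/-- The (semi)norm `‖a‖ = inf {q ≥ 0 | |a| ≤ q e}` attached to a strong unit `e`. -/
noncomputable def unitNorm {E : Type*} [AddCommGroup E] [Lattice E] [Module ℝ E]
    (e a : E) : ℝ :=
  sInf {q : ℝ | 0 ≤ q ∧ |a| ≤ q • e}

/-- A Riesz morphism: a linear map that preserves finite suprema and infima. -/
def IsRieszHom {E B : Type*} [AddCommGroup E] [Lattice E] [Module ℝ E]
    [AddCommGroup B] [Lattice B] [Module ℝ B] (T : E →ₗ[ℝ] B) : Prop :=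
  ∀ x y : E, T (x ⊔ y) = T x ⊔ T y ∧ T (x ⊓ y) = T x ⊓ T y

/-- `ι` makes the Riesz space `E` with strong unit `e` a dense part of the f-algebra `B`:
it is a norm-preserving Riesz morphism that sends `e` to the multiplicative unit of `B` and
whose image is dense for the uniform topology. (An inclusion of a Riesz subspace that contains
`1` is automatically norm-preserving.) -/
structure IsDenseIn {E B : Type*} [AddCommGroup E] [Lattice E] [Module ℝ E]
    [Ring B] [Lattice B] [Algebra ℝ B] (e : E) (ι : E →ₗ[ℝ] B) : Prop where
  rieszHom : IsRieszHom ι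
  map_unit : ι e = 1
  norm_map : ∀ f : E, unitNorm (1 : B) (ι f) = unitNorm e f
  dense : ∀ x : B, ∀ ε : ℝ, 0 < ε → ∃ f : E, |x - ι f| ≤ ε • (1 : B)

/-- A subset `S` of a Riesz space is (relatively) uniformly complete if every sequence in `S`
that is uniformly Cauchy with a regulator `u ∈ S` converges `u`-uniformly to an element
of `S`. -/
def IsUniformlyCompleteOn {G : Type*} [AddCommGroup G] [Lattice G] [Module ℝ G]
    (S : Set G) : Prop :=
  ∀ (x : ℕ → G) (u : G), (∀ n, x n ∈ S) → u ∈ S → 0 ≤ u →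
    (∀ ε : ℝ, 0 < ε → ∃ N : ℕ, ∀ m ≥ N, ∀ n ≥ N, |x m - x n| ≤ ε • u) →
    ∃ l ∈ S, ∀ ε : ℝ, 0 < ε → ∃ N : ℕ, ∀ n ≥ N, |x n - l| ≤ ε • u

/-- `j : F → G` is the uniform completion of the Archimedean Riesz space `F`: `G` is an
Archimedean, uniformly complete Riesz space, `j` is a Riesz embedding, and no proper
Riesz subspace of `G` that contains `j(F)` is uniformly complete. -/
structure IsUniformCompletion {F G : Type*} [AddCommGroup F] [Lattice F] [Module ℝ F]
    [AddCommGroup G] [Lattice G] [Module ℝ G] (j : F →ₗ[ℝ] G) : Prop where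
  archimedean : IsArchimedean G
  complete : IsUniformlyCompleteOn (Set.univ : Set G)
  rieszHom : IsRieszHom j
  injective : Function.Injective j
  minimal : ∀ S : Submodule ℝ G,
    (∀ x ∈ S, ∀ y ∈ S, x ⊔ y ∈ S ∧ x ⊓ y ∈ S) → LinearMap.range j ≤ S →
    IsUniformlyCompleteOn (S : Set G) → S = ⊤

/-- Positivity of a bilinear map. -/
def IsPositiveBilin {E F : Type*} [AddCommGroup E] [Lattice E] [Module ℝ E]
    [AddCommGroup F] [Lattice F] [Module ℝ F] (A : E →ₗ[ℝ] E →ₗ[ℝ] F) : Prop :=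
  ∀ f g : E, 0 ≤ f → 0 ≤ g → 0 ≤ A f g

/-- Orthosymmetry of a bilinear map. -/
def IsOrthosymmetric {E F : Type*} [AddCommGroup E] [Lattice E] [Module ℝ E]
    [AddCommGroup F] [Module ℝ F] (A : E →ₗ[ℝ] E →ₗ[ℝ] F) : Prop :=
  ∀ f g : E, f ⊓ g = 0 → A f g = 0

/-- `A'` is an orthosymmetric positive bilinear map on `B` that extends `A`, where `E` and `F`
are regarded as parts of `B` and `G` through `ι` and `j`. -/
structure IsOrthoPosExtension {E F B G : Type*}
    [AddCommGroup E] [Lattice E] [Module ℝ E] [AddCommGroup F] [Lattice F] [Module ℝ F]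
    [AddCommGroup B] [Lattice B] [Module ℝ B] [AddCommGroup G] [Lattice G] [Module ℝ G]
    (ι : E →ₗ[ℝ] B) (j : F →ₗ[ℝ] G) (A : E →ₗ[ℝ] E →ₗ[ℝ] F)
    (A' : B →ₗ[ℝ] B →ₗ[ℝ] G) : Prop where
  orthosymmetric : IsOrthosymmetric A'
  positive : IsPositiveBilin A'
  extends_map : ∀ f g : E, A' (ι f) (ι g) = j (A f g)

end Riesz

/-!
The heart of the matter is a weak symmetry of positive orthosymmetric bilinear maps: if `A` takes
values in an Archimedean space and `0 ≤ f ≤ n • e`, then `A e f = A f e`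
(`IsOrthosymmetric.apply_comm_of_nonneg`). To see this, cut `f` into horizontal slices of height
`v = δ • e`. Where a slice is nonzero, the slice below it is full, so orthosymmetry replaces the
commutator of `A` at `v` and a slice by the commutator at the slice and its predecessor's excess
over it. These excesses are nonnegative with sum at most `v`, so the commutator at `v` and `f` is
bounded by `A v v = δ ^ 2 • A e e`, whatever the number of slices
(`abs_apply_sub_apply_swap_le`). Hence `|A e f - A f e| ≤ δ • A e e` for every `δ > 0`.

In an f-algebra whose multiplicative unit is a strong unit, multiplication by `a ≥ 0` preserves
disjointness, so the symmetry also applies to `(x, y) ↦ A (a * x) y`, giving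
`A a y = A (a * y) 1 = A 1 (a * y)`. Thus every positive orthosymmetric map into an Archimedean
space is multiplication followed by the linear map `A 1`
(`IsOrthosymmetric.apply_eq_apply_one_mul`), with no appeal to commutativity of the algebra.

It remains to extend `j ∘ A` to the f-algebra. A positive bilinear map is Lipschitz on bounded sets
for the seminorms given by the units (`IsPositiveBilin.abs_sub_le`), so uniform completeness of the
target provides an extension by density (`exists_bilin_isDenseLimit`), and the Archimedean property
makes it unique. Lattice operations are uniformly continuous, so that positivity and
orthosymmetry pass to the extension (`IsDenseLimit.nonneg`, `IsDenseLimit.eq_zero`).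
-/

namespace Riesz

/-! ### Riesz spaces and the Archimedean property -/

section Basic

theorem abs_le_of_neg_le_of_le {E : Type*} [AddCommGroup E] [Lattice E] [IsOrderedAddMonoid E]
    {a b : E} (h₁ : -b ≤ a) (h₂ : a ≤ b) : |a| ≤ b :=
  abs_le'.2 ⟨h₂, neg_le.1 h₁⟩

theorem unitNorm_le {E : Type*} [AddCommGroup E] [Lattice E] [Module ℝ E] {e f : E} {q : ℝ}
    (hq : 0 ≤ q) (hf : |f| ≤ q • e) : unitNorm e f ≤ q :=
  csInf_le ⟨0, fun _ h => h.1⟩ ⟨hq, hf⟩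

theorem IsRieszHom.monotone {E F : Type*} [AddCommGroup E] [Lattice E] [Module ℝ E]
    [AddCommGroup F] [Lattice F] [Module ℝ F] {T : E →ₗ[ℝ] F} (hT : IsRieszHom T) :
    Monotone T := fun x y h => by
  have := (hT x y).1
  rw [sup_eq_right.2 h] at this
  exact le_of_le_of_eq le_sup_left this.symm

theorem IsRieszHom.abs_map {E F : Type*} [AddCommGroup E] [Lattice E] [Module ℝ E]
    [AddCommGroup F] [Lattice F] [Module ℝ F] {T : E →ₗ[ℝ] F} (hT : IsRieszHom T) (x : E) :
    |T x| = T |x| := by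
  rw [abs, abs, (hT x (-x)).1, map_neg]

variable {E F : Type*} [AddCommGroup E] [Lattice E] [Module ℝ E] [IsRieszSpace E]
  [AddCommGroup F] [Lattice F] [Module ℝ F] [IsRieszSpace F]

theorem abs_real_smul_le (r : ℝ) (x : E) : |r • x| ≤ |r| • |x| := by
  rcases le_total 0 r with hr | hr
  · rw [abs_of_nonneg hr]
    refine abs_le'.2 ⟨smul_le_smul_of_nonneg_left (le_abs_self x) hr, ?_⟩
    rw [← smul_neg]
    exact smul_le_smul_of_nonneg_left (neg_le_abs x) hr
  · rw [abs_of_nonpos hr]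
    have hr' : 0 ≤ -r := neg_nonneg.2 hr
    refine abs_le'.2 ⟨?_, ?_⟩
    · rw [← neg_smul_neg]
      exact smul_le_smul_of_nonneg_left (neg_le_abs x) hr'
    · rw [← neg_smul]
      exact smul_le_smul_of_nonneg_left (le_abs_self x) hr'

theorem abs_le_smul_add {a b e : E} {p q : ℝ} (ha : |a| ≤ p • e) (hb : |b| ≤ q • e) :
    |a + b| ≤ (p + q) • e := by
  rw [add_smul]
  exact (abs_add_le a b).trans (add_le_add ha hb)

theorem abs_le_smul_trans {a b c e : E} {p q : ℝ} (h₁ : |a - b| ≤ p • e)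
    (h₂ : |b - c| ≤ q • e) : |a - c| ≤ (p + q) • e := by
  simpa using abs_le_smul_add h₁ h₂

theorem abs_le_smul_mono {a e : E} {p q : ℝ} (he : 0 ≤ e) (h : |a| ≤ p • e) (hpq : p ≤ q) :
    |a| ≤ q • e :=
  h.trans (smul_le_smul_of_nonneg_right hpq he)

theorem abs_inf_sub_inf_le_smul {x x' y y' e : E} {p q : ℝ} (hx : |x - x'| ≤ p • e)
    (hy : |y - y'| ≤ q • e) : |x ⊓ y - x' ⊓ y'| ≤ (p + q) • e := by
  refine abs_le_smul_trans (b := x' ⊓ y) ((abs_inf_sub_inf_le_abs x x' y).trans hx) ?_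
  rw [inf_comm x' y, inf_comm x' y']
  exact (abs_inf_sub_inf_le_abs y y' x').trans hy

theorem IsArchimedean.eq_zero_of_forall_abs_le_smul (hF : IsArchimedean F) {x u : F}
    (h : ∀ ε : ℝ, 0 < ε → |x| ≤ ε • u) : x = 0 := by
  have hu : 0 ≤ u := by simpa using (abs_nonneg x).trans (h 1 one_pos)
  refine hF x u fun n => ?_
  have h₁ := smul_le_smul_of_nonneg_left (h ((n : ℝ) + 1)⁻¹ (by positivity))
    (Nat.cast_nonneg (α := ℝ) n)
  rw [Nat.cast_smul_eq_nsmul, smul_smul] at h₁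
  refine h₁.trans ((smul_le_smul_of_nonneg_right (?_ : _ ≤ (1 : ℝ)) hu).trans_eq (one_smul ℝ u))
  rw [← div_eq_mul_inv, div_le_one (by positivity)]
  linarith

theorem IsArchimedean.nonneg_of_forall_neg_smul_le (hF : IsArchimedean F) {x u : F}
    (hu : 0 ≤ u) (h : ∀ ε : ℝ, 0 < ε → -(ε • u) ≤ x) : 0 ≤ x := by
  have h₀ : x ⊓ 0 = 0 := hF.eq_zero_of_forall_abs_le_smul (u := u) fun ε hε => by
    have hεu : 0 ≤ ε • u := smul_nonneg hε.le hu
    exact abs_le_of_neg_le_of_le (le_inf (h ε hε) (neg_nonpos.2 hεu)) (inf_le_right.trans hεu)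
  exact inf_eq_right.1 h₀

theorem IsStrongUnit.nonneg {e : E} (he : IsStrongUnit e) : 0 ≤ e := by
  obtain ⟨n, hn⟩ := he e
  have h : (0 : E) ≤ (n : ℝ) • e := by
    rw [Nat.cast_smul_eq_nsmul]; exact (abs_nonneg e).trans hn
  rcases Nat.eq_zero_or_pos n with rfl | hpos
  · rw [zero_smul] at hn
    exact (neg_nonpos.1 ((neg_le_abs e).trans hn))
  · have hn' : (0 : ℝ) < n := Nat.cast_pos.2 hpos
    have := smul_nonneg (inv_nonneg.2 hn'.le) h
    rwa [inv_smul_smul₀ hn'.ne'] at this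

theorem abs_le_of_unitNorm_le {e : E} (he : IsStrongUnit e) {f : E} {q r : ℝ}
    (hf : unitNorm e f ≤ q) (hqr : q < r) : |f| ≤ r • e := by
  obtain ⟨n, hn⟩ := he f
  rw [← Nat.cast_smul_eq_nsmul ℝ] at hn
  obtain ⟨p, hp, hpr⟩ := exists_lt_of_csInf_lt
    (s := {q : ℝ | 0 ≤ q ∧ |f| ≤ q • e}) ⟨n, n.cast_nonneg, hn⟩ (hf.trans_lt hqr)
  exact abs_le_smul_mono he.nonneg hp.2 hpr.le

end Basic

/-! ### Positive orthosymmetric bilinear maps -/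

section Bilinear

variable {E F : Type*} [AddCommGroup E] [Lattice E] [Module ℝ E] [IsRieszSpace E]
  [AddCommGroup F] [Lattice F] [Module ℝ F] [IsRieszSpace F] {A : E →ₗ[ℝ] E →ₗ[ℝ] F}

theorem nonneg_of_two_smul_nonneg {x : F} (h : 0 ≤ (2 : ℝ) • x) : 0 ≤ x := by
  have := smul_nonneg (by norm_num : (0 : ℝ) ≤ 2⁻¹) h
  rwa [inv_smul_smul₀ two_ne_zero] at this

theorem IsPositiveBilin.mono (hA : IsPositiveBilin A) {f f' g g' : E} (hf : 0 ≤ f) (hff : f ≤ f')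
    (hg : 0 ≤ g) (hgg : g ≤ g') : A f g ≤ A f' g' := by
  have h₁ := hA (f' - f) g (sub_nonneg.2 hff) hg
  have h₂ := hA f' (g' - g) (hf.trans hff) (sub_nonneg.2 hgg)
  rw [map_sub, LinearMap.sub_apply, sub_nonneg] at h₁
  rw [map_sub, sub_nonneg] at h₂
  exact h₁.trans h₂

theorem IsPositiveBilin.abs_apply_le (hA : IsPositiveBilin A) (f g : E) :
    |A f g| ≤ A |f| |g| := by
  have hf₁ : 0 ≤ |f| - f := sub_nonneg.2 (le_abs_self f)
  have hf₂ : 0 ≤ |f| + f := neg_le_iff_add_nonneg.1 (neg_le_abs f)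
  have hg₁ : 0 ≤ |g| - g := sub_nonneg.2 (le_abs_self g)
  have hg₂ : 0 ≤ |g| + g := neg_le_iff_add_nonneg.1 (neg_le_abs g)
  refine abs_le'.2 ⟨sub_nonneg.1 (nonneg_of_two_smul_nonneg ?_),
    sub_nonneg.1 (nonneg_of_two_smul_nonneg ?_)⟩
  · refine (add_nonneg (hA _ _ hf₁ hg₂) (hA _ _ hf₂ hg₁)).trans_eq ?_
    simp only [map_sub, map_add, LinearMap.sub_apply, LinearMap.add_apply]
    module
  · refine (add_nonneg (hA _ _ hf₁ hg₁) (hA _ _ hf₂ hg₂)).trans_eq ?_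
    simp only [map_sub, map_add, LinearMap.sub_apply, LinearMap.add_apply]
    module

theorem IsPositiveBilin.abs_apply_le_smul (hA : IsPositiveBilin A) {e f g : E} {p q : ℝ}
    (hf : |f| ≤ p • e) (hg : |g| ≤ q • e) : |A f g| ≤ (p * q) • A e e := by
  refine (hA.abs_apply_le f g).trans ((hA.mono (abs_nonneg f) hf (abs_nonneg g) hg).trans_eq ?_)
  simp [smul_smul, mul_comm]

/-- A positive bilinear map is Lipschitz on order intervals for the uniform structures given by
`e` and `A e e`. -/
theorem IsPositiveBilin.abs_sub_le (hA : IsPositiveBilin A) {e f f' g g' : E} {C δ : ℝ}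
    (hf' : |f'| ≤ C • e) (hg : |g| ≤ C • e) (hff : |f - f'| ≤ δ • e) (hgg : |g - g'| ≤ δ • e) :
    |A f g - A f' g'| ≤ (2 * C * δ) • A e e := by
  have h := abs_le_smul_add (hA.abs_apply_le_smul hff hg) (hA.abs_apply_le_smul hf' hgg)
  convert h using 2
  · simp only [map_sub, LinearMap.sub_apply]; abel
  · ring

/-- The sequence `s (k + 1)` stands for the consecutive slices of an element cut at the multiples
of `v`. By `hd`, the map `A` does not distinguish `v` from `s k` against `s (k + 1)`, so the
commutator at `v` and `s (k + 1)` equals the one at `s k - s (k + 1)` and `s (k + 1)`; since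
`s (k + 1) ≤ v` and the differences telescope, these add up to at most `A v v`. -/
theorem abs_apply_sum_sub_le (hA : IsOrthosymmetric A) (hA' : IsPositiveBilin A) {v : E}
    {s : ℕ → E} (hs₀ : s 0 = v) (hs : Antitone s) (hs' : ∀ k, 0 ≤ s k)
    (hd : ∀ k, (v - s k) ⊓ s (k + 1) = 0) (N : ℕ) :
    |A v (∑ k ∈ Finset.range N, s (k + 1)) - A (∑ k ∈ Finset.range N, s (k + 1)) v| ≤ A v v := by
  have hsv : ∀ k, s k ≤ v := fun k => hs₀ ▸ hs (Nat.zero_le k)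
  have hv : 0 ≤ v := hs₀ ▸ hs' 0
  have hstep : ∀ k, A v (s (k + 1)) - A (s (k + 1)) v =
      A (s k - s (k + 1)) (s (k + 1)) - A (s (k + 1)) (s k - s (k + 1)) := fun k => by
    have h₁ := hA _ _ (hd k)
    have h₂ := hA _ _ ((inf_comm _ _).trans (hd k))
    rw [map_sub, LinearMap.sub_apply, sub_eq_zero] at h₁
    rw [map_sub, sub_eq_zero] at h₂
    simp only [map_sub, LinearMap.sub_apply, h₁, h₂]
    abel
  have htel : ∑ k ∈ Finset.range N, (s k - s (k + 1)) ≤ v := by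
    rw [Finset.sum_range_sub', hs₀]
    exact sub_le_self _ (hs' N)
  have hnn : 0 ≤ ∑ k ∈ Finset.range N, (s k - s (k + 1)) :=
    Finset.sum_nonneg fun k _ => sub_nonneg.2 (hs k.le_succ)
  have hX : ∑ k ∈ Finset.range N, A (s k - s (k + 1)) (s (k + 1)) ≤ A v v := by
    refine le_trans ?_ (hA'.mono hnn htel hv le_rfl)
    rw [map_sum, LinearMap.sum_apply]
    exact Finset.sum_le_sum fun k _ =>
      hA'.mono (sub_nonneg.2 (hs k.le_succ)) le_rfl (hs' _) (hsv _)
  have hY : ∑ k ∈ Finset.range N, A (s (k + 1)) (s k - s (k + 1)) ≤ A v v := by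
    refine le_trans ?_ (hA'.mono hv le_rfl hnn htel)
    rw [map_sum]
    exact Finset.sum_le_sum fun k _ =>
      hA'.mono (hs' _) (hsv _) (sub_nonneg.2 (hs k.le_succ)) le_rfl
  have hX₀ : 0 ≤ ∑ k ∈ Finset.range N, A (s k - s (k + 1)) (s (k + 1)) :=
    Finset.sum_nonneg fun k _ => hA' _ _ (sub_nonneg.2 (hs k.le_succ)) (hs' _)
  have hY₀ : 0 ≤ ∑ k ∈ Finset.range N, A (s (k + 1)) (s k - s (k + 1)) :=
    Finset.sum_nonneg fun k _ => hA' _ _ (hs' _) (sub_nonneg.2 (hs k.le_succ))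
  rw [map_sum, map_sum, LinearMap.sum_apply, ← Finset.sum_sub_distrib,
    Finset.sum_congr rfl fun k _ => hstep k, Finset.sum_sub_distrib]
  refine abs_le'.2 ⟨(sub_le_self _ hY₀).trans hX, ?_⟩
  rw [neg_sub]
  exact (sub_le_self _ hX₀).trans hY

/-- If `f ≤ N • v`, cut `f` into slices of height `v`: the commutator of `A` at `v` and `f` is at most `A v v`,
however large the multiple of `v` needed to dominate `f`. -/
theorem abs_apply_sub_apply_swap_le (hA : IsOrthosymmetric A) (hA' : IsPositiveBilin A) {v f : E}
    (hv : 0 ≤ v) (hf : 0 ≤ f) {N : ℕ} (hfN : f ≤ N • v) : |A v f - A f v| ≤ A v v := by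
  -- `c k` is the part of `f` above height `k • v`, and `c k - c (k + 1) = c k ⊓ v`.
  set c : ℕ → E := fun k => (f - k • v)⁺ with hc
  have hc_succ : ∀ k, c (k + 1) = (c k - v)⁺ := fun k => by
    simp only [hc, posPart_def, succ_nsmul]
    rw [sup_sub, sup_assoc, zero_sub, sup_eq_right.2 (neg_nonpos.2 hv), sub_sub]
  have hc_inf : ∀ k, c k - c (k + 1) = c k ⊓ v := fun k => by
    rw [hc_succ, inf_eq_sub_posPart_sub]
  have hc_nonneg : ∀ k, 0 ≤ c k := fun k => posPart_nonneg _
  have hc_anti : ∀ k, c (k + 1) ≤ c k := fun k => by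
    rw [← sub_nonneg, hc_inf]; exact le_inf (hc_nonneg k) hv
  let s : ℕ → E := fun k => Nat.casesOn k v fun k => c k - c (k + 1)
  have hs₀ : s 0 = v := rfl
  have hs_succ : ∀ k, s (k + 1) = c k ⊓ v := hc_inf
  have hs_nonneg : ∀ k, 0 ≤ s k := fun k => by
    cases k with
    | zero => exact hv
    | succ k => rw [hs_succ]; exact le_inf (hc_nonneg k) hv
  have hs_anti : Antitone s := antitone_nat_of_succ_le fun k => by
    cases k with
    | zero => rw [hs_succ, hs₀]; exact inf_le_right
    | succ k => rw [hs_succ, hs_succ]; exact inf_le_inf_right _ (hc_anti k)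
  have hd : ∀ k, (v - s k) ⊓ s (k + 1) = 0 := fun k => by
    cases k with
    | zero => rw [hs₀, sub_self]; exact inf_eq_left.2 (hs_nonneg 1)
    | succ k =>
      have h₁ : v - s (k + 1) = (c k - v)⁻ := by
        rw [hs_succ, inf_comm, inf_eq_sub_posPart_sub, sub_sub_cancel, ← posPart_neg, neg_sub]
      refine le_antisymm ?_ (le_inf (sub_nonneg.2 (hs_anti (Nat.zero_le (k + 1)))) (hs_nonneg (k + 1 + 1)))
      rw [h₁, hs_succ, hc_succ, ← posPart_inf_negPart_eq_zero (c k - v), inf_comm]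
      exact inf_le_inf_right _ inf_le_left
  have hsum : ∑ k ∈ Finset.range N, s (k + 1) = f := by
    have : ∑ k ∈ Finset.range N, (c k - c (k + 1)) = f := by
      rw [Finset.sum_range_sub']
      have h₀ : c 0 = f := by simp [hc, hf]
      have hN : c N = 0 := posPart_eq_zero.2 (sub_nonpos.2 hfN)
      rw [h₀, hN, sub_zero]
    exact this
  have := abs_apply_sum_sub_le hA hA' hs₀ hs_anti hs_nonneg hd N
  rwa [hsum] at this

/-- Slicing `f` at height `δ • e` bounds the commutator by `δ • A e e`; let `δ` tend to `0`. -/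
theorem IsOrthosymmetric.apply_comm_of_nonneg (hA : IsOrthosymmetric A) (hA' : IsPositiveBilin A)
    (hF : IsArchimedean F) {e f : E} (he : 0 ≤ e) (hf : 0 ≤ f) {n : ℕ} (hfn : f ≤ n • e) :
    A e f = A f e := by
  refine sub_eq_zero.1 (hF.eq_zero_of_forall_abs_le_smul (u := A e e) fun ε hε => ?_)
  obtain ⟨N, hN⟩ := exists_nat_ge ((n : ℝ) / ε)
  have hfN : f ≤ N • (ε • e) := by
    refine hfn.trans ?_
    rw [← Nat.cast_smul_eq_nsmul ℝ n, ← Nat.cast_smul_eq_nsmul ℝ N, smul_smul]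
    exact smul_le_smul_of_nonneg_right ((div_le_iff₀ hε).1 hN) he
  have h := abs_apply_sub_apply_swap_le hA hA' (smul_nonneg hε.le he) hf hfN
  -- Both sides are homogeneous in `e`; divide by `ε`.
  have h' := smul_le_smul_of_nonneg_left h (inv_nonneg.2 hε.le)
  have hε' : A e f - A f e = ε⁻¹ • (A (ε • e) f - A f (ε • e)) := by
    simp [← smul_sub, inv_smul_smul₀ hε.ne']
  rw [hε']
  refine (abs_real_smul_le _ _).trans ?_
  rw [abs_of_pos (inv_pos.2 hε)]
  refine h'.trans_eq ?_
  simp [inv_smul_smul₀ hε.ne']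

end Bilinear

/-! ### Extension to the ambient f-algebra by density -/

section Extension

set_option linter.unusedSectionVars false

variable {E B G : Type*} [AddCommGroup E] [Lattice E] [Module ℝ E] [IsRieszSpace E]
  [Ring B] [Lattice B] [Algebra ℝ B] [IsFAlgebra B]
  [AddCommGroup G] [Lattice G] [Module ℝ G] [IsRieszSpace G]
  {e : E} {ι : E →ₗ[ℝ] B} {T : E →ₗ[ℝ] E →ₗ[ℝ] G}

theorem IsDenseIn.abs_le (hι : IsDenseIn e ι) (he : IsStrongUnit e) {f : E} {q r : ℝ}
    (hq : 0 ≤ q) (hf : |ι f| ≤ q • (1 : B)) (hqr : q < r) : |f| ≤ r • e :=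
  abs_le_of_unitNorm_le he ((hι.norm_map f).symm.trans_le (unitNorm_le hq hf)) hqr

theorem IsDenseIn.isStrongUnit_one (hι : IsDenseIn e ι) (he : IsStrongUnit e) :
    IsStrongUnit (1 : B) := fun x => by
  obtain ⟨f, hf⟩ := hι.dense x 1 one_pos
  obtain ⟨n, hn⟩ := he f
  have hιf : |ι f| ≤ (n : ℝ) • (1 : B) := by
    rw [hι.rieszHom.abs_map, Nat.cast_smul_eq_nsmul, ← hι.map_unit, ← map_nsmul]
    exact hι.rieszHom.monotone hn
  refine ⟨1 + n, ?_⟩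
  rw [← Nat.cast_smul_eq_nsmul ℝ]
  simpa using abs_le_smul_add hf hιf

/-- `l` is the limit of `T f g` in the `T e e`-uniform sense as `ι f → x` and `ι g → y` uniformly,
i.e. `l` is the value at `(x, y)` that uniform continuity forces on an extension of `T`. -/
def IsDenseLimit (e : E) (ι : E →ₗ[ℝ] B) (T : E →ₗ[ℝ] E →ₗ[ℝ] G) (x y : B) (l : G) : Prop :=
  ∀ ε : ℝ, 0 < ε → ∃ δ : ℝ, 0 < δ ∧ ∀ f g : E,
    |x - ι f| ≤ δ • (1 : B) → |y - ι g| ≤ δ • (1 : B) → |T f g - l| ≤ ε • T e e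

/-- Two pairs of approximations of `(x, y)` have close values under `T`. -/
theorem IsDenseIn.abs_apply_sub_apply_le (hι : IsDenseIn e ι) (he : IsStrongUnit e)
    (hT : IsPositiveBilin T) {x y : B} {C δ : ℝ} (hδ : 0 < δ) (hδ' : δ ≤ 1) (hC : 0 ≤ C)
    (hx : |x| ≤ C • (1 : B)) (hy : |y| ≤ C • (1 : B)) {f f' g g' : E}
    (hf : |x - ι f| ≤ δ • (1 : B)) (hf' : |x - ι f'| ≤ δ • (1 : B))
    (hg : |y - ι g| ≤ δ • (1 : B)) (hg' : |y - ι g'| ≤ δ • (1 : B)) :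
    |T f g - T f' g'| ≤ (6 * (C + 2) * δ) • T e e := by
  have hbound : ∀ {z : B} {h : E}, |z| ≤ C • (1 : B) → |z - ι h| ≤ δ • (1 : B) →
      |h| ≤ (C + 2) • e := fun {z h} hz hzh => by
    rw [abs_sub_comm] at hzh
    have : |ι h - 0| ≤ (δ + C) • (1 : B) := abs_le_smul_trans hzh (by simpa using hz)
    rw [sub_zero] at this
    exact hι.abs_le he (by positivity) this (by linarith)
  have hclose : ∀ {z : B} {h h' : E}, |z - ι h| ≤ δ • (1 : B) → |z - ι h'| ≤ δ • (1 : B) →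
      |h - h'| ≤ (3 * δ) • e := fun {z h h'} h₁ h₂ => by
    rw [abs_sub_comm] at h₁
    have := abs_le_smul_trans h₁ h₂
    rw [← map_sub] at this
    exact hι.abs_le he (by positivity) this (by linarith)
  convert hT.abs_sub_le (hbound hx hf') (hbound hy hg) (hclose hf hf') (hclose hg hg') using 2
  ring

theorem IsDenseLimit.unique (hG : IsArchimedean G) (hι : IsDenseIn e ι) {x y : B} {l l' : G}
    (h : IsDenseLimit e ι T x y l) (h' : IsDenseLimit e ι T x y l') : l = l' := by
  refine sub_eq_zero.1 (hG.eq_zero_of_forall_abs_le_smul (u := T e e) fun ε hε => ?_)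
  obtain ⟨δ, hδ, H⟩ := h (ε / 2) (half_pos hε)
  obtain ⟨δ', hδ', H'⟩ := h' (ε / 2) (half_pos hε)
  obtain ⟨f, hf⟩ := hι.dense x _ (lt_min hδ hδ')
  obtain ⟨g, hg⟩ := hι.dense y _ (lt_min hδ hδ')
  have h₀ : (0 : B) ≤ 1 := zero_le_one
  have h₁ := H f g (abs_le_smul_mono h₀ hf (min_le_left _ _))
    (abs_le_smul_mono h₀ hg (min_le_left _ _))
  have h₂ := H' f g (abs_le_smul_mono h₀ hf (min_le_right _ _))
    (abs_le_smul_mono h₀ hg (min_le_right _ _))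
  rw [abs_sub_comm] at h₁
  simpa using abs_le_smul_trans h₁ h₂

theorem IsDenseLimit.eq_apply (hG : IsArchimedean G) {f g : E} {l : G}
    (h : IsDenseLimit e ι T (ι f) (ι g) l) : T f g = l := by
  refine sub_eq_zero.1 (hG.eq_zero_of_forall_abs_le_smul (u := T e e) fun ε hε => ?_)
  obtain ⟨δ, hδ, H⟩ := h ε hε
  have h₀ : (0 : B) ≤ δ • 1 := smul_nonneg hδ.le zero_le_one
  exact H f g (by simpa using h₀) (by simpa using h₀)

theorem IsDenseLimit.exists (hι : IsDenseIn e ι) (he : IsStrongUnit e) (hT : IsPositiveBilin T)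
    (hG : IsUniformlyCompleteOn (Set.univ : Set G)) (x y : B) :
    ∃ l, IsDenseLimit e ι T x y l := by
  have hu : 0 ≤ T e e := hT _ _ he.nonneg he.nonneg
  have h₀ : (0 : B) ≤ 1 := zero_le_one
  obtain ⟨C, hC, hx, hy⟩ : ∃ C : ℝ, 0 ≤ C ∧ |x| ≤ C • (1 : B) ∧ |y| ≤ C • (1 : B) := by
    obtain ⟨m, hm⟩ := hι.isStrongUnit_one he x
    obtain ⟨n, hn⟩ := hι.isStrongUnit_one he y
    rw [← Nat.cast_smul_eq_nsmul ℝ] at hm hn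
    exact ⟨m + n, by positivity, abs_le_smul_mono h₀ hm (by simp), abs_le_smul_mono h₀ hn (by simp)⟩
  -- `r ε` is a precision that makes any two values of `T` differ by at most `ε • T e e`.
  set K : ℝ := 6 * (C + 2) with hK
  have hKpos : 0 < K := by positivity
  let r : ℝ → ℝ := fun ε => min 1 (ε / K)
  have hr : ∀ ε, 0 < ε → 0 < r ε := fun ε hε => lt_min one_pos (div_pos hε hKpos)
  have key : ∀ ε, 0 < ε → ∀ f f' g g' : E, |x - ι f| ≤ r ε • (1 : B) →
      |x - ι f'| ≤ r ε • (1 : B) → |y - ι g| ≤ r ε • (1 : B) → |y - ι g'| ≤ r ε • (1 : B) →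
      |T f g - T f' g'| ≤ ε • T e e := fun ε hε f f' g g' hf hf' hg hg' => by
    refine abs_le_smul_mono hu (hι.abs_apply_sub_apply_le he hT (hr ε hε) (min_le_left _ _) hC
      hx hy hf hf' hg hg') ?_
    calc K * r ε ≤ K * (ε / K) := mul_le_mul_of_nonneg_left (min_le_right _ _) hKpos.le
      _ = ε := mul_div_cancel₀ _ hKpos.ne'
  choose f hf using fun n : ℕ => hι.dense x (1 / ((n : ℝ) + 1)) Nat.one_div_pos_of_nat
  choose g hg using fun n : ℕ => hι.dense y (1 / ((n : ℝ) + 1)) Nat.one_div_pos_of_nat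
  have hN : ∀ ε, 0 < ε → ∃ N : ℕ, ∀ n ≥ N,
      |x - ι (f n)| ≤ r ε • (1 : B) ∧ |y - ι (g n)| ≤ r ε • (1 : B) := fun ε hε => by
    obtain ⟨N, hN⟩ := exists_nat_one_div_lt (hr ε hε)
    exact ⟨N, fun n hn =>
      have hle := (Nat.one_div_le_one_div hn).trans hN.le
      ⟨abs_le_smul_mono h₀ (hf n) hle, abs_le_smul_mono h₀ (hg n) hle⟩⟩
  obtain ⟨l, -, hl⟩ := hG (fun n => T (f n) (g n)) (T e e) (fun _ => Set.mem_univ _)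
    (Set.mem_univ _) hu fun ε hε => by
      obtain ⟨N, hN⟩ := hN ε hε
      exact ⟨N, fun m hm n hn => key ε hε _ _ _ _ (hN m hm).1 (hN n hn).1 (hN m hm).2 (hN n hn).2⟩
  refine ⟨l, fun ε hε => ⟨r (ε / 2), hr _ (half_pos hε), fun f' g' hf' hg' => ?_⟩⟩
  obtain ⟨N, hN⟩ := hN (ε / 2) (half_pos hε)
  obtain ⟨N', hN'⟩ := hl (ε / 2) (half_pos hε)
  have h₁ := hN (max N N') (le_max_left _ _)
  simpa using abs_le_smul_trans (key (ε / 2) (half_pos hε) _ _ _ _ hf' h₁.1 hg' h₁.2)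
    (hN' (max N N') (le_max_right _ _))

theorem IsDenseLimit.swap {x y : B} {l : G} (h : IsDenseLimit e ι T x y l) :
    IsDenseLimit e ι T.flip y x l := fun ε hε => by
  obtain ⟨δ, hδ, H⟩ := h ε hε
  exact ⟨δ, hδ, fun f g hf hg => H g f hg hf⟩

theorem IsDenseLimit.add_left (hG : IsArchimedean G) (hι : IsDenseIn e ι) {x x' y : B} {l l' m : G}
    (h : IsDenseLimit e ι T x y l) (h' : IsDenseLimit e ι T x' y l')
    (hm : IsDenseLimit e ι T (x + x') y m) : m = l + l' := by
  refine sub_eq_zero.1 (hG.eq_zero_of_forall_abs_le_smul (u := T e e) fun ε hε => ?_)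
  obtain ⟨δ, hδ, H⟩ := h (ε / 3) (by positivity)
  obtain ⟨δ', hδ', H'⟩ := h' (ε / 3) (by positivity)
  obtain ⟨δ₂, hδ₂, H₂⟩ := hm (ε / 3) (by positivity)
  have h₀ : (0 : B) ≤ 1 := zero_le_one
  obtain ⟨ρ, hρ, h₁, h₂, h₃⟩ : ∃ ρ : ℝ, 0 < ρ ∧ ρ ≤ δ ∧ ρ ≤ δ' ∧ ρ + ρ ≤ δ₂ := by
    refine ⟨min δ (min δ' (δ₂ / 2)), by positivity, min_le_left _ _,
      (min_le_right _ _).trans (min_le_left _ _), ?_⟩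
    have := (min_le_right δ (min δ' (δ₂ / 2))).trans (min_le_right _ _)
    linarith
  obtain ⟨f, hf⟩ := hι.dense x ρ hρ
  obtain ⟨f', hf'⟩ := hι.dense x' ρ hρ
  obtain ⟨g, hg⟩ := hι.dense y ρ hρ
  have k₁ := H f g (abs_le_smul_mono h₀ hf h₁) (abs_le_smul_mono h₀ hg h₁)
  have k₂ := H' f' g (abs_le_smul_mono h₀ hf' h₂) (abs_le_smul_mono h₀ hg h₂)
  have hff : |x + x' - ι (f + f')| ≤ (ρ + ρ) • (1 : B) := by
    rw [map_add, add_sub_add_comm]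
    exact abs_le_smul_add hf hf'
  have k₃ := H₂ (f + f') g (abs_le_smul_mono h₀ hff h₃) (abs_le_smul_mono h₀ hg (by linarith))
  rw [abs_sub_comm] at k₃
  have := abs_le_smul_add k₃ (abs_le_smul_add k₁ k₂)
  convert this using 2
  · simp only [map_add, LinearMap.add_apply]; abel
  · ring

theorem IsDenseLimit.smul_left (hG : IsArchimedean G) (hι : IsDenseIn e ι) {x y : B} {l m : G}
    {c : ℝ} (h : IsDenseLimit e ι T x y l) (hm : IsDenseLimit e ι T (c • x) y m) : m = c • l := by
  refine sub_eq_zero.1 (hG.eq_zero_of_forall_abs_le_smul (u := T e e) fun ε hε => ?_)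
  have hc : 0 < |c| + 1 := by positivity
  obtain ⟨δ, hδ, H⟩ := h (ε / (2 * (|c| + 1))) (by positivity)
  obtain ⟨δ₂, hδ₂, H₂⟩ := hm (ε / 2) (by positivity)
  have h₀ : (0 : B) ≤ 1 := zero_le_one
  have hδc : 0 < δ₂ / (|c| + 1) := by positivity
  obtain ⟨f, hf⟩ := hι.dense x _ (lt_min hδ hδc)
  obtain ⟨g, hg⟩ := hι.dense y _ (lt_min hδ hδ₂)
  have hu : 0 ≤ (ε / 2) • T e e := by
    obtain ⟨g', hg'⟩ := hι.dense y δ₂ hδ₂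
    obtain ⟨f', hf'⟩ := hι.dense (c • x) δ₂ hδ₂
    exact (abs_nonneg _).trans (H₂ f' g' hf' hg')
  have k₁ := H f g (abs_le_smul_mono h₀ hf (min_le_left _ _))
    (abs_le_smul_mono h₀ hg (min_le_left _ _))
  have hcf : |c • x - ι (c • f)| ≤ δ₂ • (1 : B) := by
    rw [map_smul, ← smul_sub]
    refine (abs_real_smul_le _ _).trans ((smul_le_smul_of_nonneg_left
      (abs_le_smul_mono h₀ hf (min_le_right _ _)) (abs_nonneg c)).trans ?_)
    rw [smul_smul]
    refine smul_le_smul_of_nonneg_right ?_ h₀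
    rw [mul_div_assoc', div_le_iff₀ hc]
    nlinarith
  have k₂ := H₂ (c • f) g hcf (abs_le_smul_mono h₀ hg (min_le_right _ _))
  rw [abs_sub_comm] at k₂
  have k₁' : |T (c • f) g - c • l| ≤ (ε / 2) • T e e := by
    rw [map_smul, LinearMap.smul_apply, ← smul_sub]
    refine (abs_real_smul_le _ _).trans ((smul_le_smul_of_nonneg_left k₁ (abs_nonneg c)).trans ?_)
    have h₄ : |c| • (ε / (2 * (|c| + 1))) • T e e = (|c| / (|c| + 1)) • (ε / 2) • T e e := by
      rw [smul_smul, smul_smul]; congr 1; field_simp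
    rw [h₄]
    refine (smul_le_smul_of_nonneg_right (?_ : _ ≤ (1 : ℝ)) hu).trans_eq (one_smul _ _)
    rw [div_le_one hc]; linarith
  simpa using abs_le_smul_trans k₂ k₁'

/-- A positive bilinear map extends by density to a bilinear map with values in a uniformly
complete space. -/
theorem exists_bilin_isDenseLimit (hι : IsDenseIn e ι) (he : IsStrongUnit e)
    (hT : IsPositiveBilin T) (hG : IsArchimedean G)
    (hG' : IsUniformlyCompleteOn (Set.univ : Set G)) :
    ∃ A : B →ₗ[ℝ] B →ₗ[ℝ] G, ∀ x y, IsDenseLimit e ι T x y (A x y) := by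
  choose φ hφ using IsDenseLimit.exists (T := T) hι he hT hG'
  exact ⟨LinearMap.mk₂ ℝ φ
    (fun x x' y => (hφ x y).add_left hG hι (hφ x' y) (hφ _ _))
    (fun c x y => (hφ x y).smul_left hG hι (hφ _ _))
    (fun x y y' => (hφ x y).swap.add_left hG hι (hφ x y').swap (hφ _ _).swap)
    (fun c x y => (hφ x y).swap.smul_left hG hι (hφ _ _).swap), hφ⟩

theorem IsDenseLimit.nonneg (hG : IsArchimedean G) (hι : IsDenseIn e ι) (he : IsStrongUnit e)
    (hT : IsPositiveBilin T) {x y : B} {l : G} (h : IsDenseLimit e ι T x y l) (hx : 0 ≤ x)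
    (hy : 0 ≤ y) : 0 ≤ l := by
  refine hG.nonneg_of_forall_neg_smul_le (hT _ _ he.nonneg he.nonneg) fun ε hε => ?_
  obtain ⟨δ, hδ, H⟩ := h ε hε
  obtain ⟨f, hf⟩ := hι.dense x δ hδ
  obtain ⟨g, hg⟩ := hι.dense y δ hδ
  have hpos : ∀ {z : B} {k : E}, 0 ≤ z → |z - ι k| ≤ δ • (1 : B) →
      |z - ι (k ⊔ 0)| ≤ δ • (1 : B) := fun {z k} hz hk => by
    rw [(hι.rieszHom k 0).1, map_zero]
    nth_rewrite 1 [← sup_eq_left.2 hz]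
    exact (abs_sup_sub_sup_le_abs z (ι k) 0).trans hk
  have h₁ := (le_abs_self _).trans (H _ _ (hpos hx hf) (hpos hy hg))
  have h₂ : 0 ≤ T (f ⊔ 0) (g ⊔ 0) := hT _ _ le_sup_right le_sup_right
  rw [neg_le_iff_add_nonneg']
  exact h₂.trans (sub_le_iff_le_add.1 h₁)

theorem IsDenseLimit.eq_zero (hG : IsArchimedean G) (hι : IsDenseIn e ι)
    (hT : IsOrthosymmetric T) {x y : B} {l : G} (h : IsDenseLimit e ι T x y l)
    (hxy : x ⊓ y = 0) : l = 0 := by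
  refine hG.eq_zero_of_forall_abs_le_smul (u := T e e) fun ε hε => ?_
  obtain ⟨δ, hδ, H⟩ := h ε hε
  have hδ' : 0 < δ / 3 := by positivity
  obtain ⟨f, hf⟩ := hι.dense x _ hδ'
  obtain ⟨g, hg⟩ := hι.dense y _ hδ'
  -- Subtracting the small element `f ⊓ g` makes the approximations disjoint.
  have hfg : |ι (f ⊓ g)| ≤ (δ / 3 + δ / 3) • (1 : B) := by
    have := abs_inf_sub_inf_le_smul hf hg
    rwa [hxy, zero_sub, abs_neg, ← (hι.rieszHom f g).2] at this
  have hsub : ∀ {z : B} {k : E}, |z - ι k| ≤ (δ / 3) • (1 : B) →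
      |z - ι (k - f ⊓ g)| ≤ δ • (1 : B) := fun {z k} hk => by
    rw [map_sub, ← sub_add]
    convert abs_le_smul_add hk hfg using 2
    ring
  have h₁ := H _ _ (hsub hf) (hsub hg)
  have h₂ : (f - f ⊓ g) ⊓ (g - f ⊓ g) = 0 := by rw [← inf_sub, sub_self]
  rwa [hT _ _ h₂, zero_sub, abs_neg] at h₁

/-- Any positive bilinear extension of `T` is its extension by density; this is where uniqueness
comes from. -/
theorem IsDenseLimit.of_isPositiveBilin (hι : IsDenseIn e ι) (he : IsStrongUnit e)
    {A : B →ₗ[ℝ] B →ₗ[ℝ] G} (hA : IsPositiveBilin A) (hAT : ∀ f g, A (ι f) (ι g) = T f g)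
    (x y : B) : IsDenseLimit e ι T x y (A x y) := fun ε hε => by
  have h₀ : (0 : B) ≤ 1 := zero_le_one
  obtain ⟨m, hm⟩ := hι.isStrongUnit_one he x
  obtain ⟨n, hn⟩ := hι.isStrongUnit_one he y
  rw [← Nat.cast_smul_eq_nsmul ℝ] at hm hn
  set C : ℝ := m + n + 1 with hC
  have hCpos : 0 < C := by positivity
  refine ⟨min 1 (ε / (2 * C)), by positivity, fun f g hf hg => ?_⟩
  set δ : ℝ := min 1 (ε / (2 * C)) with hδ
  have hg' : |ι g| ≤ C • (1 : B) := by
    rw [abs_sub_comm] at hg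
    have := abs_le_smul_add hg hn
    rw [sub_add_cancel] at this
    refine abs_le_smul_mono h₀ this ?_
    have : δ ≤ 1 := min_le_left _ _
    have : (0 : ℝ) ≤ m := m.cast_nonneg
    linarith
  have hx : |x| ≤ C • (1 : B) :=
    abs_le_smul_mono h₀ hm (by rw [hC]; linarith [n.cast_nonneg (α := ℝ)])
  rw [abs_sub_comm] at hf hg
  have h := hA.abs_sub_le hx hg' hf hg
  rw [hAT, ← hι.map_unit, hAT] at h
  have hu : 0 ≤ T e e := by
    rw [← hAT, hι.map_unit]; exact hA _ _ h₀ h₀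
  refine abs_le_smul_mono hu h ?_
  calc 2 * C * δ ≤ 2 * C * (ε / (2 * C)) :=
        mul_le_mul_of_nonneg_left (min_le_right _ _) (by positivity)
    _ = ε := mul_div_cancel₀ _ (by positivity)

end Extension

/-! ### Representation by multiplication in an f-algebra -/

section FAlgebra

variable {B G : Type*} [Ring B] [Lattice B] [Algebra ℝ B] [IsFAlgebra B]
  [AddCommGroup G] [Lattice G] [Module ℝ G] [IsRieszSpace G] {A : B →ₗ[ℝ] B →ₗ[ℝ] G}

/-- For `a ≥ 0` the map `(x, y) ↦ A (a * x) y` is again positive and orthosymmetric. -/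
theorem IsOrthosymmetric.apply_eq_apply_one_mul_of_nonneg (hA : IsOrthosymmetric A)
    (hA' : IsPositiveBilin A) (hG : IsArchimedean G) (h1 : IsStrongUnit (1 : B)) {a y : B}
    (ha : 0 ≤ a) (hy : 0 ≤ y) : A a y = A 1 (a * y) := by
  have comm : ∀ {A : B →ₗ[ℝ] B →ₗ[ℝ] G}, IsOrthosymmetric A → IsPositiveBilin A → ∀ {z : B},
      0 ≤ z → A 1 z = A z 1 := fun {A} h h' {z} hz => by
    obtain ⟨n, hn⟩ := h1 z
    exact h.apply_comm_of_nonneg h' hG zero_le_one hz ((le_abs_self z).trans hn)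
  have h₁ : IsOrthosymmetric (A ∘ₗ LinearMap.mulLeft ℝ a) := fun f g hfg =>
    hA _ _ (IsFAlgebra.mul_left_inf_eq_zero f g a hfg ha)
  have h₂ : IsPositiveBilin (A ∘ₗ LinearMap.mulLeft ℝ a) := fun f g hf hg =>
    hA' _ _ (mul_nonneg ha hf) hg
  have h₃ := comm h₁ h₂ hy
  simp only [LinearMap.comp_apply, LinearMap.mulLeft_apply, mul_one] at h₃
  rw [h₃, comm hA hA' (mul_nonneg ha hy)]

theorem IsOrthosymmetric.apply_eq_apply_one_mul (hA : IsOrthosymmetric A)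
    (hA' : IsPositiveBilin A) (hG : IsArchimedean G) (h1 : IsStrongUnit (1 : B)) (x y : B) :
    A x y = A 1 (x * y) := by
  have h : ∀ {a b : B}, 0 ≤ a → 0 ≤ b → A a b = A 1 (a * b) := fun ha hb =>
    hA.apply_eq_apply_one_mul_of_nonneg hA' hG h1 ha hb
  rw [← posPart_sub_negPart x, ← posPart_sub_negPart y]
  simp only [map_sub, LinearMap.sub_apply, mul_sub, sub_mul,
    h (posPart_nonneg x) (posPart_nonneg y), h (posPart_nonneg x) (negPart_nonneg y),
    h (negPart_nonneg x) (posPart_nonneg y), h (negPart_nonneg x) (negPart_nonneg y)]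

end FAlgebra

end Riesz

theorem mainTheorem3
    {E F B G : Type*}
    [AddCommGroup E] [Lattice E] [Module ℝ E] [IsRieszSpace E]
    [AddCommGroup F] [Lattice F] [Module ℝ F] [IsRieszSpace F]
    [Ring B] [Lattice B] [Algebra ℝ B] [IsFAlgebra B]
    [AddCommGroup G] [Lattice G] [Module ℝ G] [IsRieszSpace G]
    (e : E) (he : Riesz.IsStrongUnit e)
    (hF : Riesz.IsArchimedean F)
    (A : E →ₗ[ℝ] E →ₗ[ℝ] F)
    (hA : Riesz.IsOrthosymmetric A) (hA' : Riesz.IsPositiveBilin A)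
    (ι : E →ₗ[ℝ] B) (hι : Riesz.IsDenseIn e ι)
    (j : F →ₗ[ℝ] G) (hj : Riesz.IsUniformCompletion j) :
    ∃ A' : B →ₗ[ℝ] B →ₗ[ℝ] G,
      Riesz.IsOrthoPosExtension ι j A A' ∧
      (∀ A'' : B →ₗ[ℝ] B →ₗ[ℝ] G, Riesz.IsOrthoPosExtension ι j A A'' → A'' = A') ∧
      ∀ f g : E, j (A f g) = A' 1 (ι f * ι g) := by
  let T : E →ₗ[ℝ] E →ₗ[ℝ] G := A.compr₂ j
  have hT : Riesz.IsOrthosymmetric T := fun f g h => by simp [T, hA f g h]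
  have hT' : Riesz.IsPositiveBilin T := fun f g hf hg => by
    simpa [T] using hj.rieszHom.monotone (hA' f g hf hg)
  obtain ⟨A', hlim⟩ := Riesz.exists_bilin_isDenseLimit hι he hT' hj.archimedean hj.complete
  have hext : ∀ f g, A' (ι f) (ι g) = j (A f g) := fun f g =>
    ((hlim _ _).eq_apply hj.archimedean).symm
  have hortho : Riesz.IsOrthosymmetric A' := fun x y hxy =>
    (hlim x y).eq_zero hj.archimedean hι hT hxy
  have hpos : Riesz.IsPositiveBilin A' := fun x y hx hy =>
    (hlim x y).nonneg hj.archimedean hι he hT' hx hy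
  refine ⟨A', ⟨hortho, hpos, hext⟩, fun A'' h => ?_, fun f g => ?_⟩
  · refine LinearMap.ext₂ fun x y => ?_
    exact (Riesz.IsDenseLimit.of_isPositiveBilin hι he h.positive h.extends_map x y).unique
      hj.archimedean hι (hlim x y)
  · rw [← hext, hortho.apply_eq_apply_one_mul hpos hj.archimedean (hι.isStrongUnit_one he)]
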